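/- Let $M$ be a compact, connected, orientable 3-manifold with a fiber bundle structure $p\colon M\to S^1$ whose fiber is a compact surface $\Sigma$ (possibly with boundary). A bubble is an essential (not null-homotopic) simple closed curve lying on a fiber surface and disjoint from $\partial M$. Let $\beta_1,\dots,\beta_n$ be bubbles lying on pairwise distinct fiber surfaces, let $N(\beta_1),\dots,N(\beta_n)$ be disjoint regular (closed tubular) neighborhoods of them, and let $E=M\setminus\bigcup_i \mathring N(\beta_i)$ be the bubble-drilled manifold. On the torus $\partial N(\beta_i)$ let $m_i$ be the meridian of $N(\beta_i)$, and let the distinguished longitude $l_i$ be the push-off of $\beta_i$ in the normal direction inside the fiber surface that contains $\beta_i$. For integers $k_1,\dots,k_n$ let $E(k_1,\dots,k_n)$ be the Dehn filling of $E$ along $(m_1+k_1l_1,\dots,m_n+k_nl_n)$, that is, the space obtained from $E$ by gluing, for each $i$, a solid torus to $E$ along $\partial N(\beta_i)$ by a homeomorphism of boundary tori that takes the meridian of the solid torus to a simple closed curve isotopic to $m_i+k_il_i$. Then for all integers $k_1,\dots,k_n$ the Dehn filling $E(k_1,\dots,k_n)$ is again the total space of a fiber bundle over $S^1$ with fiber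 homeomorphic to $\Sigma$. -/

import Mathlib

open Set Topology

/-- `p : M → B` is a locally trivial fiber bundle with fiber `F`. -/
def IsLocallyTrivialBundle {M B : Type*} [TopologicalSpace M] [TopologicalSpace B]
    (F : Type*) [TopologicalSpace F] (p : M → B) : Prop :=
  ∀ b : B, ∃ e : Bundle.Trivialization F p, b ∈ e.baseSet

/-- `H` is an ambient isotopy of `X`, starting at the identity. -/
structure IsAmbientIsotopy {X : Type*} [TopologicalSpace X] (H : unitInterval × X → X) :
    Prop where
  continuous : Continuous H
  isHomeomorph : ∀ t, IsHomeomorph fun x => H (t, x)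
  zero : ∀ x, H (0, x) = x

/-- Two subsets of `X` (for instance two simple closed curves) are ambient isotopic. -/
def AmbientIsotopic {X : Type*} [TopologicalSpace X] (A B : Set X) : Prop :=
  ∃ H : unitInterval × X → X, IsAmbientIsotopy H ∧ (fun x => H (1, x)) '' A = B

section Bubbles

variable {M : Type*} [TopologicalSpace M]

/-- A bubble on the fiber surface `p ⁻¹' {t}`: an essential (that is, not null-homotopic in the
fiber surface) simple closed curve. -/
structure IsBubble {p : M → Circle} {t : Circle} (γ : C(Circle, p ⁻¹' {t})) : Prop where
  injective : Function.Injective γ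
  essential : ¬ γ.Nullhomotopic

/-- The open solid torus `S¹ × {|w| < r}`. -/
def openTube (r : ℝ) : Set (Circle × ℂ) := univ ×ˢ Metric.ball (0 : ℂ) r

/-- The closed solid torus `S¹ × {|w| ≤ r}`. -/
def closedTube (r : ℝ) : Set (Circle × ℂ) := univ ×ˢ Metric.closedBall (0 : ℂ) r

/-- `τ` parametrizes a tubular neighborhood of the curve `γ` lying on the fiber over `t` as
(annulus in the fiber direction) × (interval in the base direction): the core `w = 0` is `γ`, and
`τ (z, w)` lies at height `ε * Im w` above the fiber over `t`. In particular the circles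
`z ↦ τ (z, s)` with `s` real are the parallel copies of `γ` in its own fiber surface. -/
structure IsProductTube {p : M → Circle} {t : Circle} (γ : C(Circle, p ⁻¹' {t}))
    (τ : Circle × ℂ → M) : Prop where
  isOpenEmbedding : IsOpenEmbedding ((openTube 2).domRestrict τ)
  core : ∀ z, τ (z, 0) = γ z
  height : ∃ ε : ℝ, 0 < ε ∧ ε < Real.pi / 2 ∧
    ∀ x ∈ openTube 2, p (τ x) = t * Circle.exp (ε * x.2.im)

/-- `ν` is a system of framed regular neighborhoods `N i = ν i (S¹ × {|w| ≤ 1})` of the link with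
components `γ i`: up to an ambient isotopy of `M` that fixes the link, the `N i` are disjoint
product tubes. (Regular neighborhoods of a link are unique up to such isotopies.)

The torus `∂ N i` carries the meridian `m i : u ↦ ν i (1, u)` and the distinguished longitude
`l i : z ↦ ν i (z, 1)`, which the isotopy makes into the push-off of `γ i` in its fiber. -/
def IsRegularNeighborhood {n : ℕ} {p : M → Circle} {t : Fin n → Circle}
    (γ : ∀ i, C(Circle, p ⁻¹' {t i})) (ν : Fin n → Circle × ℂ → M) : Prop :=
  ∃ (τ : Fin n → Circle × ℂ → M) (H : unitInterval × M → M),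
    (∀ i, IsProductTube (γ i) (τ i)) ∧
    (Pairwise fun i j => Disjoint (τ i '' closedTube 1) (τ j '' closedTube 1)) ∧
    IsAmbientIsotopy H ∧
    (∀ s i z, H (s, (γ i z : M)) = γ i z) ∧
    ∀ i, ∀ x ∈ closedTube 1, ν i x = H (1, τ i x)

/-- The drilled manifold `E = M ∖ ⋃ i, int N i`. -/
abbrev DrilledManifold {n : ℕ} (ν : Fin n → Circle × ℂ → M) : Type _ :=
  {x : M // x ∉ ⋃ i, ν i '' openTube 1}

/-- The linear simple closed curve on the torus `S¹ × S¹` in the class of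
`meridian + k • longitude`, where the meridian is `{1} × S¹` and the longitude is `S¹ × {1}`. -/
def slopeCurve (k : ℤ) : Set (Circle × Circle) := range fun u : Circle => (u ^ k, u)

/-- `g` is a homeomorphism from the boundary `S¹ × S¹` of a solid torus `S¹ × D²` onto `∂ N`,
where `N = ν (S¹ × {|w| ≤ 1})`, that sends the meridian `{1} × ∂D²` to a simple closed curve
isotopic in `∂ N` to `m + k l`. -/
def IsAttachingMap (ν : Circle × ℂ → M) (k : ℤ) (g : Circle × Circle → M) : Prop :=
  ∃ a : Circle × Circle ≃ₜ Circle × Circle,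
    AmbientIsotopic (a '' ({1} ×ˢ univ)) (slopeCurve k) ∧
    ∀ x, g x = ν ((a x).1, ((a x).2 : ℂ))

end Bubbles

/-- The solid torus `S¹ × D²`, whose meridian disks are `{z} × D²`. -/
abbrev SolidTorus : Type := Circle × Metric.closedBall (0 : ℂ) 1

/-- The inclusion of the boundary torus `S¹ × S¹` into the solid torus `S¹ × D²`. -/
def SolidTorus.boundary (x : Circle × Circle) : SolidTorus :=
  (x.1, ⟨(x.2 : ℂ), by simp [Circle.norm_coe]⟩)

/-- The identifications `g i x ∼ x` for `x` in the boundary of the `i`-th solid torus. -/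
inductive DehnFillingRel {ι X : Type*} (g : ι → Circle × Circle → X) :
    X ⊕ (Σ _ : ι, SolidTorus) → X ⊕ (Σ _ : ι, SolidTorus) → Prop
  | glue (i : ι) (x : Circle × Circle) :
      DehnFillingRel g (Sum.inl (g i x)) (Sum.inr ⟨i, SolidTorus.boundary x⟩)

/-- The Dehn filling of `X`: the quotient space (with the quotient topology) obtained by attaching
one solid torus for each index `i` along its boundary, through `g i`. -/
abbrev DehnFilling {ι X : Type*} (g : ι → Circle × Circle → X) : Type _ :=
  Quot (DehnFillingRel g)

theorem IsLocallyTrivialBundle.continuous {M B F : Type*} [TopologicalSpace M]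
    [TopologicalSpace B] [TopologicalSpace F] {p : M → B} (hp : IsLocallyTrivialBundle F p) :
    Continuous p := by
  refine continuous_iff_continuousAt.2 fun x => ?_
  obtain ⟨e, he⟩ := hp (p x)
  exact e.continuousAt_proj (e.mem_source.2 he)

/-- A map from a compact space that is locally over the base isomorphic to a fiber bundle, through
continuous bijections, is a fiber bundle. -/
theorem IsLocallyTrivialBundle.of_locally_bijOn {Z M B F : Type*} [TopologicalSpace Z]
    [CompactSpace Z] [TopologicalSpace M] [T2Space M] [TopologicalSpace B] [RegularSpace B]
    [TopologicalSpace F] {p : M → B} (hp : IsLocallyTrivialBundle F p) {q : Z → B}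
    (hq : Continuous q)
    (H : ∀ b, ∃ U, IsOpen U ∧ b ∈ U ∧ ∃ Φ : Z → M, ContinuousOn Φ (q ⁻¹' U) ∧
      BijOn Φ (q ⁻¹' U) (p ⁻¹' U) ∧ ∀ z ∈ q ⁻¹' U, p (Φ z) = q z) :
    IsLocallyTrivialBundle F q := by
  intro b
  obtain ⟨U, hU, hbU, Φ, hΦc, hΦ, hpΦ⟩ := H b
  obtain ⟨e, he⟩ := hp b
  obtain ⟨K, hK, hKc, hKU⟩ := exists_mem_nhds_isClosed_subset (hU.mem_nhds hbU)
  have hsub : q ⁻¹' K ⊆ q ⁻¹' U := preimage_mono hKU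
  have hbij : BijOn Φ (q ⁻¹' K) (p ⁻¹' K) := by
    refine ⟨fun z hz => ?_, hΦ.injOn.mono hsub, fun m hm => ?_⟩
    · have := hpΦ z (hsub hz)
      simpa [mem_preimage, this] using hz
    · obtain ⟨z, hz, rfl⟩ := hΦ.surjOn (hKU hm : m ∈ p ⁻¹' U)
      exact ⟨z, by simpa [mem_preimage, hpΦ z hz] using hm, rfl⟩
  have : CompactSpace (q ⁻¹' K) := isCompact_iff_compactSpace.1 (hKc.preimage hq).isCompact
  let E : q ⁻¹' K ≃ p ⁻¹' K := BijOn.equiv Φ hbij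
  have hE : Continuous E :=
    ((hΦc.mono hsub).domRestrict).subtype_mk _
  let E' : q ⁻¹' K ≃ₜ p ⁻¹' K := hE.homeoOfEquivCompactToT2
  classical
  have hne : M → Nonempty Z := fun m => by
    obtain ⟨U', -, hmU', Φ', -, hΦ', -⟩ := H (p m)
    obtain ⟨z, -⟩ := hΦ'.surjOn (hmU' : m ∈ p ⁻¹' U')
    exact ⟨z⟩
  let Ψ : M → Z := fun m => if h : m ∈ p ⁻¹' K then E'.symm ⟨m, h⟩ else (hne m).some
  have hΨK : ∀ m (h : m ∈ p ⁻¹' K), Ψ m = E'.symm ⟨m, h⟩ := fun m h => dif_pos h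
  have hΨc : ContinuousOn Ψ (p ⁻¹' K) := by
    rw [continuousOn_iff_continuous_domRestrict]
    have : (p ⁻¹' K).domRestrict Ψ = fun m => (E'.symm m : Z) := by
      ext m; exact hΨK m.1 m.2
    rw [this]
    exact continuous_subtype_val.comp E'.symm.continuous
  have hright : ∀ m ∈ p ⁻¹' K, Φ (Ψ m) = m := by
    intro m hm
    rw [hΨK m hm]
    exact congrArg Subtype.val (E'.apply_symm_apply ⟨m, hm⟩)
  have hqΨ : ∀ m ∈ p ⁻¹' K, Ψ m ∈ q ⁻¹' K := fun m hm => by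
    rw [hΨK m hm]; exact (E'.symm ⟨m, hm⟩).2
  have hleft : ∀ z ∈ q ⁻¹' K, Ψ (Φ z) = z := fun z hz =>
    hbij.injOn (hqΨ _ (hbij.mapsTo hz)) hz (hright _ (hbij.mapsTo hz))
  have hpc := hp.continuous
  let V := interior K
  have hVK : V ⊆ K := interior_subset
  let ℓ : OpenPartialHomeomorph Z M :=
    { toFun := Φ
      invFun := Ψ
      source := q ⁻¹' V
      target := p ⁻¹' V
      map_source' := fun z hz => by
        simpa [mem_preimage, hpΦ z (hsub (hVK hz))] using hz
      map_target' := fun m hm => by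
        have h1 := hqΨ m (hVK hm)
        have h2 := hpΦ _ (hsub h1)
        rw [hright m (hVK hm)] at h2
        simpa [mem_preimage, ← h2] using hm
      left_inv' := fun z hz => hleft z (hVK hz)
      right_inv' := fun m hm => hright m (hVK hm)
      open_source := isOpen_interior.preimage hq
      open_target := isOpen_interior.preimage hpc
      continuousOn_toFun := hΦc.mono fun z hz => hsub (hVK hz)
      continuousOn_invFun := hΨc.mono fun m hm => hVK hm }
  refine ⟨{ toOpenPartialHomeomorph := ℓ.trans e.toOpenPartialHomeomorph
            baseSet := V ∩ e.baseSet
            open_baseSet := isOpen_interior.inter e.open_baseSet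
            source_eq := ?_
            target_eq := ?_
            proj_toFun := ?_ }, mem_interior_iff_mem_nhds.2 hK, he⟩
  · ext z
    simp only [OpenPartialHomeomorph.trans_source, mem_inter_iff, mem_preimage, e.mem_source]
    refine and_congr_right fun hz => ?_
    rw [show p (ℓ z) = q z from hpΦ z (hsub (hVK hz))]
  · ext ⟨y, f⟩
    simp only [OpenPartialHomeomorph.trans_target, mem_inter_iff, mem_preimage, e.mem_target,
      mem_prod, mem_univ, and_true]
    rw [and_comm]
    refine and_congr_left fun hy => ?_
    change p (e.toOpenPartialHomeomorph.symm (y, f)) ∈ V ↔ _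
    rw [e.proj_symm_apply' hy]
  · intro z hz
    rw [OpenPartialHomeomorph.trans_source] at hz
    change (e (Φ z)).1 = q z
    refine (e.coe_fst hz.2).trans ?_
    exact hpΦ z (hsub (hVK hz.1))

/-- A self-map `Γ` upstairs with inverse `Γ'` modulo the fibers of `π` descends to a homeomorphism. -/
theorem exists_homeomorph_of_semiconj {Y X : Type*} [TopologicalSpace Y] [CompactSpace Y]
    [TopologicalSpace X] [T2Space X] {π : Y → X} (hπ : Continuous π)
    (hsurj : Function.Surjective π) {Γ Γ' : Y → Y} (hΓ : Continuous (π ∘ Γ))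
    (h : ∀ y y', π y = π y' → π (Γ y) = π (Γ y'))
    (h' : ∀ y y', π y = π y' → π (Γ' y) = π (Γ' y'))
    (hleft : ∀ y, π (Γ' (Γ y)) = π y) (hright : ∀ y, π (Γ (Γ' y)) = π y) :
    ∃ C : X ≃ₜ X, ∀ y, C (π y) = π (Γ y) := by
  have : CompactSpace X := hsurj.compactSpace hπ
  have hquot : IsQuotientMap π := hπ.isClosedMap.isQuotientMap hπ hsurj
  let s := Function.surjInv hsurj
  have hs : ∀ x, π (s x) = x := Function.surjInv_eq hsurj
  let E : X ≃ X :=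
    { toFun := fun x => π (Γ (s x))
      invFun := fun x => π (Γ' (s x))
      left_inv := fun x => by
        dsimp only
        rw [h' _ (Γ (s x)) (hs _), hleft, hs]
      right_inv := fun x => by
        dsimp only
        rw [h _ (Γ' (s x)) (hs _), hright, hs] }
  have hE : ∀ y, E (π y) = π (Γ y) := fun y => h _ _ (hs _)
  have hEc : Continuous E := by
    rw [hquot.continuous_iff]
    convert hΓ using 1
    exact funext hE
  exact ⟨hEc.homeoOfEquivCompactToT2, hE⟩

/-- The point at radius `r` over a point of the boundary torus. -/
def SolidTorus.polar (y : unitInterval × Circle × Circle) : SolidTorus :=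
  (y.2.1, ⟨(y.1 : ℝ) * (y.2.2 : ℂ), by
    simpa [Circle.norm_coe, abs_of_nonneg y.1.2.1] using y.1.2.2⟩)

theorem SolidTorus.continuous_polar : Continuous SolidTorus.polar := by
  unfold SolidTorus.polar
  fun_prop

theorem SolidTorus.polar_one (x : Circle × Circle) :
    SolidTorus.polar (1, x) = SolidTorus.boundary x := by
  simp [SolidTorus.polar, SolidTorus.boundary]

/-- Every complex number has polar coordinates. -/
theorem Complex.exists_eq_norm_mul_circle (w : ℂ) : ∃ u : Circle, w = ‖w‖ * (u : ℂ) :=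
  ⟨Circle.exp w.arg, by rw [Circle.coe_exp, Complex.norm_mul_exp_arg_mul_I]⟩

theorem SolidTorus.polar_surjective : Function.Surjective SolidTorus.polar := by
  rintro ⟨z, w, hw⟩
  obtain ⟨u, hu⟩ := Complex.exists_eq_norm_mul_circle w
  refine ⟨(⟨‖w‖, norm_nonneg w, by simpa using hw⟩, z, u), ?_⟩
  simp [SolidTorus.polar, ← hu]

/-- Equality of points in polar form. -/
theorem Circle.real_mul_eq_iff {r r' : ℝ} (hr : 0 ≤ r) (hr' : 0 ≤ r') {u u' : Circle} :
    (r : ℂ) * (u : ℂ) = r' * (u' : ℂ) ↔ r = r' ∧ (r = 0 ∨ u = u') := by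
  constructor
  · intro h
    have h1 : r = r' := by
      have := congrArg norm h
      simpa [Circle.norm_coe, abs_of_nonneg hr, abs_of_nonneg hr'] using this
    refine ⟨h1, ?_⟩
    subst h1
    rcases eq_or_ne r 0 with h0 | h0
    · exact Or.inl h0
    · exact Or.inr (Circle.ext (mul_left_cancel₀ (Complex.ofReal_ne_zero.2 h0) h))
  · rintro ⟨rfl, rfl | rfl⟩ <;> simp

theorem SolidTorus.polar_eq_iff {r r' : unitInterval} {z z' u u' : Circle} :
    SolidTorus.polar (r, z, u) = SolidTorus.polar (r', z', u') ↔
      z = z' ∧ r = r' ∧ (r = 0 ∨ u = u') := by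
  simp only [SolidTorus.polar, Prod.mk.injEq,
    Circle.real_mul_eq_iff r.2.1 r'.2.1, Subtype.ext_iff, Icc.coe_zero]

/-- A homeomorphism of the boundary torus that is isotopic to the identity extends over the solid
torus. -/
theorem IsAmbientIsotopy.exists_solidTorus_extension
    {J : unitInterval × (Circle × Circle) → Circle × Circle} (hJ : IsAmbientIsotopy J) :
    ∃ C : SolidTorus ≃ₜ SolidTorus,
      ∀ x, C (SolidTorus.boundary x) = SolidTorus.boundary (J (1, x)) := by
  let J' : unitInterval → Circle × Circle → Circle × Circle := fun r =>
    Function.surjInv (hJ.isHomeomorph r).surjective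
  have hright : ∀ r x, J (r, J' r x) = x := fun r =>
    Function.surjInv_eq (hJ.isHomeomorph r).surjective
  have hleft : ∀ r x, J' r (J (r, x)) = x := fun r x =>
    (hJ.isHomeomorph r).injective (hright r _)
  have hJ'0 : ∀ x, J' 0 x = x := fun x => by
    conv_lhs => rw [← hJ.zero x]
    exact hleft 0 x
  obtain ⟨C, hC⟩ := exists_homeomorph_of_semiconj SolidTorus.continuous_polar
    SolidTorus.polar_surjective (Γ := fun y => (y.1, J y)) (Γ' := fun y => (y.1, J' y.1 y.2))
    (SolidTorus.continuous_polar.comp (continuous_fst.prodMk hJ.continuous))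
    (by
      rintro ⟨r, z, u⟩ ⟨r', z', u'⟩ h
      obtain ⟨rfl, rfl, rfl | rfl⟩ := SolidTorus.polar_eq_iff.1 h
      · simp only [hJ.zero]
        exact SolidTorus.polar_eq_iff.2 ⟨rfl, rfl, Or.inl rfl⟩
      · rfl)
    (by
      rintro ⟨r, z, u⟩ ⟨r', z', u'⟩ h
      obtain ⟨rfl, rfl, rfl | rfl⟩ := SolidTorus.polar_eq_iff.1 h
      · simp only [hJ'0]
        exact SolidTorus.polar_eq_iff.2 ⟨rfl, rfl, Or.inl rfl⟩
      · rfl)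
    (fun y => by simp only [hleft]) (fun y => by simp only [hright])
  refine ⟨C, fun x => ?_⟩
  rw [← SolidTorus.polar_one, hC, SolidTorus.polar_one]

/-- The quotient map from the annulus `[0, 1] × S¹` to the torus, which closes it up along the
meridian `{1} × S¹`. -/
noncomputable def annulusToTorus (x : unitInterval × Circle) : Circle × Circle :=
  (Circle.exp (2 * Real.pi * x.1), x.2)

theorem continuous_annulusToTorus : Continuous annulusToTorus := by
  unfold annulusToTorus
  fun_prop

theorem Circle.exp_two_pi_mul_eq_one {s : ℝ} :
    Circle.exp (2 * Real.pi * s) = 1 ↔ ∃ n : ℤ, s = n := by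
  rw [Circle.exp_eq_one]
  refine exists_congr fun n => ⟨fun h => ?_, fun h => by rw [h]; ring⟩
  have := Real.pi_pos
  exact mul_left_cancel₀ (by positivity : 2 * Real.pi ≠ 0) (by linarith)

theorem unitInterval.intCast_eq {s : unitInterval} {n : ℤ} (h : (s : ℝ) = n) : s = 0 ∨ s = 1 := by
  have h0 := s.2.1
  have h1 := s.2.2
  rw [h] at h0 h1
  have h0' : 0 ≤ n := by exact_mod_cast h0
  have h1' : n ≤ 1 := by exact_mod_cast h1
  obtain rfl | rfl : n = 0 ∨ n = 1 := by omega
  · left; ext; simpa using h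
  · right; ext; simpa using h

theorem Circle.exp_two_pi_unitInterval_eq_iff {s s' : unitInterval} :
    Circle.exp (2 * Real.pi * s) = Circle.exp (2 * Real.pi * s') ↔
      s = s' ∨ (s = 0 ∧ s' = 1) ∨ (s = 1 ∧ s' = 0) := by
  constructor
  · intro h
    have h2 : Circle.exp (2 * Real.pi * ((s : ℝ) - s')) = 1 := by
      rw [mul_sub, Circle.exp_sub, h, div_self']
    obtain ⟨n, hn⟩ := Circle.exp_two_pi_mul_eq_one.1 h2
    have := s.2.1
    have := s.2.2
    have := s'.2.1
    have := s'.2.2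
    have h3 : ((-1 : ℤ) : ℝ) ≤ n := by push_cast; linarith
    have h4 : (n : ℝ) ≤ ((1 : ℤ) : ℝ) := by push_cast; linarith
    have h5 : -1 ≤ n := by exact_mod_cast h3
    have h6 : n ≤ 1 := by exact_mod_cast h4
    obtain rfl | rfl | rfl : n = -1 ∨ n = 0 ∨ n = 1 := by omega
    · push_cast at hn
      exact Or.inr (Or.inl ⟨Subtype.ext (by rw [Icc.coe_zero]; linarith),
        Subtype.ext (by rw [Icc.coe_one]; linarith)⟩)
    · push_cast at hn
      exact Or.inl (Subtype.ext (by linarith))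
    · push_cast at hn
      exact Or.inr (Or.inr ⟨Subtype.ext (by rw [Icc.coe_one]; linarith),
        Subtype.ext (by rw [Icc.coe_zero]; linarith)⟩)
  · rintro (rfl | ⟨rfl, rfl⟩ | ⟨rfl, rfl⟩) <;> simp

theorem annulusToTorus_fst_eq_one {x : unitInterval × Circle} :
    (annulusToTorus x).1 = 1 ↔ x.1 = 0 ∨ x.1 = 1 := by
  refine Circle.exp_two_pi_mul_eq_one.trans ⟨fun ⟨n, hn⟩ => unitInterval.intCast_eq hn, ?_⟩
  rintro (h | h)
  · exact ⟨0, by simp [h]⟩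
  · exact ⟨1, by simp [h]⟩

theorem closure_annulus_interior :
    closure (Ioo (0 : unitInterval) 1 ×ˢ (univ : Set Circle)) = univ := by
  rw [closure_prod_eq, closure_Ioo zero_ne_one, closure_univ]
  exact eq_univ_of_forall fun x => ⟨⟨x.1.2.1, x.1.2.2⟩, mem_univ _⟩

/-- A map of the torus that preserves the meridian and its complement lifts to the annulus obtained
by cutting along the meridian. -/
theorem exists_annulus_lift {c : Circle × Circle → Circle × Circle} (hc : Continuous c)
    (h1 : ∀ x, (c x).1 = 1 ↔ x.1 = 1) :
    ∃ F : unitInterval × Circle → unitInterval × Circle, Continuous F ∧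
      (∀ x, annulusToTorus (F x) = c (annulusToTorus x)) ∧
      ((∀ u, (F (0, u)).1 = 0) ∨ ∀ u, (F (0, u)).1 = 1) ∧
      ((∀ u, (F (1, u)).1 = 0) ∨ ∀ u, (F (1, u)).1 = 1) := by
  have hpi := Real.pi_pos
  let ζ : C(unitInterval × Circle, Circle) :=
    ⟨fun x => (c (annulusToTorus x)).1, (hc.comp continuous_annulusToTorus).fst⟩
  have hζ : ∀ x, ζ x = 1 ↔ x.1 = 0 ∨ x.1 = 1 := fun x =>
    (h1 _).trans annulusToTorus_fst_eq_one
  have hζ0 : ∀ u, ζ (0, u) = Circle.exp ((ContinuousMap.const Circle (0 : ℝ)) u) := fun u => by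
    simpa using (hζ (0, u)).2 (Or.inl rfl)
  let L := Circle.isCoveringMap_exp.liftHomotopy ζ (ContinuousMap.const Circle (0 : ℝ)) hζ0
  have hL : ∀ x, Circle.exp (L x) = ζ x := fun x =>
    congrFun (Circle.isCoveringMap_exp.liftHomotopy_lifts ζ _ hζ0) x
  have hL0 : ∀ u, L (0, u) = 0 := fun u =>
    Circle.isCoveringMap_exp.liftHomotopy_zero ζ _ hζ0 u
  let τ : unitInterval × Circle → ℝ := fun x => L x / (2 * Real.pi)
  have hτc : Continuous τ := L.continuous.div_const _
  have hτ : ∀ x, Circle.exp (2 * Real.pi * τ x) = ζ x := fun x => by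
    rw [← hL x]; congr 1; simp only [τ]; field_simp
  have hτ0 : ∀ u, τ (0, u) = 0 := fun u => by simp [τ, hL0]
  have hint : ∀ x, (∃ n : ℤ, τ x = n) ↔ x.1 = 0 ∨ x.1 = 1 := fun x => by
    rw [← Circle.exp_two_pi_mul_eq_one, hτ, hζ]
  obtain ⟨m, hm⟩ : ∃ m : ℤ, ∀ x, τ x ∈ Icc (m : ℝ) (m + 1) := by
    let O : Set (unitInterval × Circle) := Ioo 0 1 ×ˢ univ
    have hO : IsPreconnected O := isPreconnected_Ioo.prod isPreconnected_univ
    have hOint : ∀ x ∈ O, ∀ n : ℤ, τ x ≠ n := by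
      intro x hx n hn
      rcases (hint x).1 ⟨n, hn⟩ with h | h
      · exact hx.1.1.ne' h
      · exact hx.1.2.ne h
    obtain ⟨a, ha⟩ : ∃ a : unitInterval, a ∈ Ioo (0 : unitInterval) 1 := exists_between zero_lt_one
    have hx0 : (a, (1 : Circle)) ∈ O := ⟨ha, mem_univ _⟩
    refine ⟨⌊τ (a, 1)⌋, fun x => ?_⟩
    have hsub : O ⊆ τ ⁻¹' Icc (⌊τ (a, 1)⌋ : ℝ) (⌊τ (a, 1)⌋ + 1) := by
      intro y hy
      constructor
      · by_contra! hlt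
        obtain ⟨w, hw, hwe⟩ := hO.intermediate_value hy hx0 hτc.continuousOn
          ⟨hlt.le, Int.floor_le _⟩
        exact hOint w hw _ hwe
      · by_contra! hlt
        obtain ⟨w, hw, hwe⟩ := hO.intermediate_value hx0 hy hτc.continuousOn
          ⟨(Int.lt_floor_add_one _).le, hlt.le⟩
        exact hOint w hw (⌊τ (a, 1)⌋ + 1) (by push_cast; exact hwe)
    have := closure_minimal hsub (isClosed_Icc.preimage hτc)
    rw [closure_annulus_interior] at this
    exact this (mem_univ x)
  let σ : unitInterval × Circle → unitInterval := fun x =>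
    ⟨τ x - m, by linarith [(hm x).1], by linarith [(hm x).2]⟩
  have hσc : Continuous σ := (hτc.sub continuous_const).subtype_mk _
  have hσend : ∀ x : unitInterval × Circle, x.1 = 0 ∨ x.1 = 1 → σ x = 0 ∨ σ x = 1 := by
    intro x hx
    obtain ⟨n, hn⟩ := (hint x).2 hx
    exact unitInterval.intCast_eq (n := n - m) (by simp [σ, hn])
  have hconst : ∀ e : unitInterval, e = 0 ∨ e = 1 → (∀ u, σ (e, u) = 0) ∨ ∀ u, σ (e, u) = 1 := by
    intro e he
    by_contra! hne
    obtain ⟨⟨u, hu⟩, v, hv⟩ := hne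
    have hu1 := (hσend (e, u) he).resolve_left hu
    have hv0 := (hσend (e, v) he).resolve_right hv
    obtain ⟨a, ha⟩ : ∃ a : unitInterval, a ∈ Ioo (0 : unitInterval) 1 := exists_between zero_lt_one
    obtain ⟨w, hw⟩ := mem_range_of_exists_le_of_exists_ge
      (hσc.comp (Continuous.prodMk_right e)) (c := a)
      ⟨v, by simp [hv0]⟩ ⟨u, by simpa [hu1] using ha.2.le⟩
    rcases hσend (e, w) he with h | h
    · exact ha.1.ne (h.symm.trans hw)
    · exact ha.2.ne' (h.symm.trans hw)
  refine ⟨fun x => (σ x, (c (annulusToTorus x)).2),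
    hσc.prodMk (hc.comp continuous_annulusToTorus).snd, fun x => Prod.ext ?_ rfl,
    hconst 0 (Or.inl rfl), hconst 1 (Or.inr rfl)⟩
  change Circle.exp (2 * Real.pi * (τ x - m)) = ζ x
  rw [mul_sub, Circle.exp_sub, hτ, Circle.exp_two_pi_mul_int, div_one]

/-- Lifts of mutually inverse maps of the torus to the annulus are mutually inverse. -/
theorem annulus_lift_leftInverse {c c' : Circle × Circle → Circle × Circle}
    (hcc : ∀ x, c' (c x) = x) {F G : unitInterval × Circle → unitInterval × Circle}
    (hF : Continuous F) (hG : Continuous G)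
    (hFc : ∀ x, annulusToTorus (F x) = c (annulusToTorus x))
    (hGc : ∀ x, annulusToTorus (G x) = c' (annulusToTorus x)) (x : unitInterval × Circle) :
    G (F x) = x := by
  have hO : EqOn (G ∘ F) id (Ioo (0 : unitInterval) 1 ×ˢ (univ : Set Circle)) := by
    rintro ⟨s, u⟩ ⟨hs, -⟩
    have h : annulusToTorus (G (F (s, u))) = annulusToTorus (s, u) := by rw [hGc, hFc, hcc]
    obtain ⟨h1, h2⟩ := Prod.ext_iff.1 h
    refine Prod.ext ?_ h2
    rcases Circle.exp_two_pi_unitInterval_eq_iff.1 h1 with h | ⟨-, h⟩ | ⟨-, h⟩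
    · exact h
    · exact absurd h hs.2.ne
    · exact absurd h hs.1.ne'
  exact congrFun (Continuous.ext_on (dense_iff_closure_eq.2 closure_annulus_interior)
    (hG.comp hF) continuous_id hO) x

/-- The homeomorphism `F` of the annulus, with inverse `G`, maps the two boundary circles to
themselves (`δ = 1`) or exchanges them (`δ = -1`). -/
theorem annulus_lift_ends {F G : unitInterval × Circle → unitInterval × Circle}
    (hGF : ∀ x, G (F x) = x)
    (hF0 : (∀ u, (F (0, u)).1 = 0) ∨ ∀ u, (F (0, u)).1 = 1)
    (hF1 : (∀ u, (F (1, u)).1 = 0) ∨ ∀ u, (F (1, u)).1 = 1)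
    (hG0 : (∀ u, (G (0, u)).1 = 0) ∨ ∀ u, (G (0, u)).1 = 1)
    (hG1 : (∀ u, (G (1, u)).1 = 0) ∨ ∀ u, (G (1, u)).1 = 1) :
    (∀ u, (F (0, u)).1 = 0 ∧ (F (1, u)).1 = 1 ∧ (G (0, u)).1 = 0 ∧ (G (1, u)).1 = 1) ∨
    (∀ u, (F (0, u)).1 = 1 ∧ (F (1, u)).1 = 0 ∧ (G (0, u)).1 = 1 ∧ (G (1, u)).1 = 0) := by
  have key : ∀ {F G : unitInterval × Circle → unitInterval × Circle} {e f g : unitInterval},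
      (∀ x, G (F x) = x) → (∀ u, (F (e, u)).1 = f) → (∀ u, (G (f, u)).1 = g) → g = e := by
    intro F G e f g h hF hG
    have h1 := h (e, 1)
    have h2 : F (e, 1) = (f, (F (e, 1)).2) := Prod.ext (hF 1) rfl
    rw [h2] at h1
    rw [← hG (F (e, 1)).2, h1]
  have h01 : (0 : unitInterval) ≠ 1 := zero_ne_one
  rcases hF0 with a | a <;> rcases hF1 with b | b <;> rcases hG0 with c | c <;>
    rcases hG1 with d | d
  all_goals first
    | exact Or.inl fun u => ⟨a u, b u, c u, d u⟩
    | exact Or.inr fun u => ⟨a u, b u, c u, d u⟩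
    | exact absurd (key hGF a c) h01
    | exact absurd (key hGF a c) h01.symm
    | exact absurd (key hGF a d) h01
    | exact absurd (key hGF a d) h01.symm
    | exact absurd (key hGF b c) h01
    | exact absurd (key hGF b c) h01.symm
    | exact absurd (key hGF b d) h01

/-- The point of the solid torus in the coordinates (radius, annulus). -/
noncomputable def SolidTorus.cutPolar (y : unitInterval × unitInterval × Circle) : SolidTorus :=
  SolidTorus.polar (y.1, annulusToTorus y.2)

theorem SolidTorus.continuous_cutPolar : Continuous SolidTorus.cutPolar :=
  SolidTorus.continuous_polar.comp
    (continuous_fst.prodMk (continuous_annulusToTorus.comp continuous_snd))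

theorem annulusToTorus_surjective : Function.Surjective annulusToTorus := by
  rintro ⟨z, u⟩
  have hpi := Real.pi_pos
  obtain ⟨s, hs, hse⟩ : ∃ s ∈ Icc (0 : ℝ) 1, Circle.exp (2 * Real.pi * s) = z := by
    rcases le_total 0 (z : ℂ).arg with h | h
    · refine ⟨(z : ℂ).arg / (2 * Real.pi), ⟨by positivity, ?_⟩, ?_⟩
      · rw [div_le_one (by positivity)]; linarith [Complex.arg_le_pi z]
      · rw [mul_div_cancel₀ _ (by positivity), Circle.exp_arg]
    · refine ⟨(z : ℂ).arg / (2 * Real.pi) + 1, ⟨?_, ?_⟩, ?_⟩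
      · have : -1 ≤ (z : ℂ).arg / (2 * Real.pi) := by
          rw [le_div_iff₀ (by positivity)]; linarith [Complex.neg_pi_lt_arg z]
        linarith
      · have : (z : ℂ).arg / (2 * Real.pi) ≤ 0 := div_nonpos_of_nonpos_of_nonneg h (by positivity)
        linarith
      · rw [mul_add, mul_div_cancel₀ _ (by positivity), mul_one, Circle.exp_add_two_pi,
          Circle.exp_arg]
  exact ⟨(⟨s, hs⟩, u), Prod.ext hse rfl⟩

theorem SolidTorus.cutPolar_surjective : Function.Surjective SolidTorus.cutPolar := by
  intro x
  obtain ⟨⟨r, y⟩, rfl⟩ := SolidTorus.polar_surjective x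
  obtain ⟨a, rfl⟩ := annulusToTorus_surjective y
  exact ⟨(r, a), rfl⟩

theorem SolidTorus.cutPolar_eq_iff {y y' : unitInterval × unitInterval × Circle} :
    SolidTorus.cutPolar y = SolidTorus.cutPolar y' ↔
      Circle.exp (2 * Real.pi * y.2.1) = Circle.exp (2 * Real.pi * y'.2.1) ∧ y.1 = y'.1 ∧
        (y.1 = 0 ∨ y.2.2 = y'.2.2) :=
  SolidTorus.polar_eq_iff

/-- The coordinate on the annulus of the point where the ray through `y` from the center of the
solid cylinder leaves through the side of the cylinder, clamped if the ray leaves through an end. -/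
noncomputable def coneCoord (y : unitInterval × unitInterval × Circle) : unitInterval × Circle :=
  (projIcc 0 1 zero_le_one (((y.2.1 : ℝ) - 1 / 2) / y.1 + 1 / 2), y.2.2)

theorem continuous_smul_comp_coneCoord {E : Type*} [NormedAddCommGroup E] [NormedSpace ℝ E]
    {f : unitInterval × Circle → E} (hf : Continuous f) :
    Continuous fun y : unitInterval × unitInterval × Circle => (y.1 : ℝ) • f (coneCoord y) := by
  refine continuous_iff_continuousAt.2 fun y => ?_
  rcases eq_or_ne (y.1 : ℝ) 0 with h | h
  · obtain ⟨B, hB⟩ := (isCompact_range hf).isBounded.exists_norm_le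
    have h1 : Filter.Tendsto (fun y : unitInterval × unitInterval × Circle => (y.1 : ℝ) * B) (𝓝 y)
        (𝓝 0) := by
      have : Continuous fun y : unitInterval × unitInterval × Circle => (y.1 : ℝ) * B := by fun_prop
      simpa [h] using this.tendsto y
    rw [ContinuousAt, h, zero_smul]
    refine squeeze_zero_norm (fun y' => ?_) h1
    rw [norm_smul, Real.norm_of_nonneg y'.1.2.1]
    exact mul_le_mul_of_nonneg_left (hB _ (mem_range_self _)) y'.1.2.1
  · have h2 : ContinuousAt coneCoord y := by
      unfold coneCoord
      refine ContinuousAt.prodMk (continuous_projIcc.continuousAt.comp ?_) (by fun_prop)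
      exact ContinuousAt.add (ContinuousAt.div (by fun_prop) (by fun_prop) h) (by fun_prop)
    exact ContinuousAt.smul (by fun_prop) (hf.continuousAt.comp h2)

/-- The cone on a homeomorphism `F` of the side `[0, 1] × S¹` of the solid cylinder, extended over
the ends, which it maps to themselves (`δ = 1`) or exchanges (`δ = -1`). -/
noncomputable def coneMap (F : unitInterval × Circle → unitInterval × Circle) (δ : ℝ)
    (y : unitInterval × unitInterval × Circle) : unitInterval × unitInterval × Circle :=
  (y.1, projIcc 0 1 zero_le_one (1 / 2 + (y.1 : ℝ) * (((F (coneCoord y)).1 : ℝ) - 1 / 2 -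
    δ * ((coneCoord y).1 - 1 / 2)) + δ * (y.2.1 - 1 / 2)), (F (coneCoord y)).2)

theorem continuous_cutPolar_coneMap {F : unitInterval × Circle → unitInterval × Circle}
    (hF : Continuous F) (δ : ℝ) : Continuous (SolidTorus.cutPolar ∘ coneMap F δ) := by
  have h1 := continuous_smul_comp_coneCoord
    (f := fun x => ((F x).1 : ℝ) - 1 / 2 - δ * (x.1 - 1 / 2)) (by fun_prop)
  have h2 := continuous_smul_comp_coneCoord (f := fun x => ((F x).2 : ℂ)) (by fun_prop)
  refine Continuous.prodMk ?_ (Continuous.subtype_mk ?_ _)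
  · refine Circle.exp.continuous.comp (continuous_const.mul (continuous_subtype_val.comp
      ((continuous_projIcc (h := zero_le_one)).comp ((continuous_const.add ?_).add (by fun_prop)))))
    simpa only [smul_eq_mul] using h1
  · simp only [Complex.real_smul] at h2
    exact h2

/-- `F` maps the ends of the annulus to themselves or exchanges them, according to `δ`. -/
structure RespectsEnds (F : unitInterval × Circle → unitInterval × Circle) (δ : ℝ) : Prop where
  sign : δ = 1 ∨ δ = -1
  left : ∀ u, ((F (0, u)).1 : ℝ) = 1 / 2 - δ / 2
  right : ∀ u, ((F (1, u)).1 : ℝ) = 1 / 2 + δ / 2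

theorem coneMap_side {F : unitInterval × Circle → unitInterval × Circle} {δ : ℝ}
    {r s x : unitInterval} (u : Circle) (hr : r ≠ 0) (hs : (s : ℝ) - 1 / 2 = r * (x - 1 / 2)) :
    ((coneMap F δ (r, s, u)).2.1 : ℝ) = 1 / 2 + r * ((F (x, u)).1 - 1 / 2) ∧
      (coneMap F δ (r, s, u)).2.2 = (F (x, u)).2 := by
  have hr' : (r : ℝ) ≠ 0 := fun h => hr (Subtype.ext h)
  have hx : coneCoord (r, s, u) = (x, u) := by
    refine Prod.ext ?_ rfl
    have : ((s : ℝ) - 1 / 2) / r + 1 / 2 = x := by rw [hs]; field_simp; ring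
    simp only [coneCoord, this, projIcc_val]
  refine ⟨?_, by simp only [coneMap, hx]⟩
  have h0 := (F (x, u)).1.2.1
  have h1 := (F (x, u)).1.2.2
  have hr0 := r.2.1
  have hr1 := r.2.2
  have : (1 / 2 + (r : ℝ) * (((F (x, u)).1 : ℝ) - 1 / 2 - δ * (x - 1 / 2)) + δ * (s - 1 / 2)) =
      1 / 2 + r * ((F (x, u)).1 - 1 / 2) := by rw [hs]; ring
  simp only [coneMap, hx, this]
  rw [projIcc_of_mem zero_le_one ⟨by nlinarith, by nlinarith⟩]

theorem RespectsEnds.coneMap_end {F : unitInterval × Circle → unitInterval × Circle} {δ : ℝ}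
    (hF : RespectsEnds F δ) {r s e : unitInterval} (u : Circle) (hr : r ≠ 0)
    (hs : (e = 0 ∧ (s : ℝ) - 1 / 2 ≤ -(r / 2)) ∨ (e = 1 ∧ (r : ℝ) / 2 ≤ s - 1 / 2)) :
    ((coneMap F δ (r, s, u)).2.1 : ℝ) = 1 / 2 + δ * (s - 1 / 2) ∧
      (coneMap F δ (r, s, u)).2.2 = (F (e, u)).2 := by
  have hr' : 0 < (r : ℝ) := lt_of_le_of_ne r.2.1 fun h => hr (Subtype.ext h.symm)
  have hx : coneCoord (r, s, u) = (e, u) := by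
    refine Prod.ext ?_ rfl
    rcases hs with ⟨rfl, hs⟩ | ⟨rfl, hs⟩
    · refine projIcc_of_le_left zero_le_one ?_
      have : ((s : ℝ) - 1 / 2) / r ≤ -(1 / 2) := by rw [div_le_iff₀ hr']; linarith
      dsimp only
      linarith
    · refine projIcc_of_right_le zero_le_one ?_
      have : 1 / 2 ≤ ((s : ℝ) - 1 / 2) / r := by rw [le_div_iff₀ hr']; linarith
      dsimp only
      linarith
  refine ⟨?_, by simp only [coneMap, hx]⟩
  have : (((F (e, u)).1 : ℝ) - 1 / 2 - δ * (e - 1 / 2)) = 0 := by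
    rcases hs with ⟨rfl, -⟩ | ⟨rfl, -⟩
    · rw [hF.left, Icc.coe_zero]; ring
    · rw [hF.right, Icc.coe_one]; ring
  simp only [coneMap, hx, this]
  have h0 := s.2.1
  have h1 := s.2.2
  rw [mul_zero, add_zero, projIcc_of_mem zero_le_one]
  rcases hF.sign with rfl | rfl <;> constructor <;> linarith

theorem RespectsEnds.coneMap_zero {F : unitInterval × Circle → unitInterval × Circle} {δ : ℝ}
    (hF : RespectsEnds F δ) (s : unitInterval) (u : Circle) :
    ((coneMap F δ (0, s, u)).2.1 : ℝ) = 1 / 2 + δ * (s - 1 / 2) := by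
  have h0 := s.2.1
  have h1 := s.2.2
  simp only [coneMap, Icc.coe_zero, zero_mul, add_zero]
  rw [projIcc_of_mem zero_le_one]
  rcases hF.sign with rfl | rfl <;> constructor <;> linarith

theorem side_or_end (r s : unitInterval) (hr : r ≠ 0) :
    (∃ x : unitInterval, (s : ℝ) - 1 / 2 = r * (x - 1 / 2)) ∨
      ∃ e : unitInterval, (e = 0 ∧ (s : ℝ) - 1 / 2 ≤ -(r / 2)) ∨
        (e = 1 ∧ (r : ℝ) / 2 ≤ s - 1 / 2) := by
  have hr' : 0 < (r : ℝ) := lt_of_le_of_ne r.2.1 fun h => hr (Subtype.ext h.symm)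
  rcases le_total ((s : ℝ) - 1 / 2) (-(r / 2)) with h | h
  · exact Or.inr ⟨0, Or.inl ⟨rfl, h⟩⟩
  rcases le_total ((r : ℝ) / 2) (s - 1 / 2) with h' | h'
  · exact Or.inr ⟨1, Or.inr ⟨rfl, h'⟩⟩
  refine Or.inl ⟨⟨((s : ℝ) - 1 / 2) / r + 1 / 2, ?_, ?_⟩, ?_⟩
  · have : -(1 / 2) ≤ ((s : ℝ) - 1 / 2) / r := by rw [le_div_iff₀ hr']; linarith
    linarith
  · have : ((s : ℝ) - 1 / 2) / r ≤ 1 / 2 := by rw [div_le_iff₀ hr']; linarith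
    linarith
  · dsimp only
    field_simp
    ring

theorem RespectsEnds.cutPolar_coneMap_coneMap
    {F G : unitInterval × Circle → unitInterval × Circle} {δ : ℝ}
    (hF : RespectsEnds F δ) (hG : RespectsEnds G δ) (hGF : ∀ x, G (F x) = x)
    (y : unitInterval × unitInterval × Circle) :
    SolidTorus.cutPolar (coneMap G δ (coneMap F δ y)) = SolidTorus.cutPolar y := by
  obtain ⟨r, s, u⟩ := y
  have hδ : δ * δ = 1 := by rcases hF.sign with rfl | rfl <;> norm_num
  set s' := (coneMap F δ (r, s, u)).2.1 with hs'
  set u' := (coneMap F δ (r, s, u)).2.2 with hu'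
  have hF' : coneMap F δ (r, s, u) = (r, s', u') := rfl
  rw [hF']
  rcases eq_or_ne r 0 with rfl | hr
  · refine SolidTorus.cutPolar_eq_iff.2 ⟨?_, rfl, Or.inl rfl⟩
    rw [hG.coneMap_zero, hs', hF.coneMap_zero]
    congr 2
    linear_combination ((s : ℝ) - 1 / 2) * hδ
  suffices h : ((coneMap G δ (r, s', u')).2.1 : ℝ) = s ∧ (coneMap G δ (r, s', u')).2.2 = u from
    SolidTorus.cutPolar_eq_iff.2 ⟨by rw [h.1], rfl, Or.inr h.2⟩
  rcases side_or_end r s hr with ⟨x, hx⟩ | ⟨e, he⟩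
  · obtain ⟨h1, h2⟩ := coneMap_side (F := F) (δ := δ) u hr hx
    obtain ⟨h3, h4⟩ := coneMap_side (F := G) (δ := δ) (s := s') (x := (F (x, u)).1) u' hr
      (by rw [hs', h1]; ring)
    have hFx : ((F (x, u)).1, u') = F (x, u) := Prod.ext rfl h2
    rw [h3, h4, hFx, hGF]
    exact ⟨by linarith, rfl⟩
  · obtain ⟨h1, h2⟩ := hF.coneMap_end u hr he
    have h1' : (s' : ℝ) = 1 / 2 + δ * (s - 1 / 2) := h1
    have hend : (((F (e, u)).1 = 0 ∧ (s' : ℝ) - 1 / 2 ≤ -(r / 2)) ∨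
        ((F (e, u)).1 = 1 ∧ (r : ℝ) / 2 ≤ s' - 1 / 2)) := by
      rw [h1']
      have hl := hF.left u
      have hrr := hF.right u
      rcases he with ⟨rfl, he⟩ | ⟨rfl, he⟩ <;> rcases hF.sign with rfl | rfl
      · exact Or.inl ⟨Subtype.ext (by rw [hl]; norm_num), by linarith⟩
      · exact Or.inr ⟨Subtype.ext (by rw [hl]; norm_num), by linarith⟩
      · exact Or.inr ⟨Subtype.ext (by rw [hrr]; norm_num), by linarith⟩
      · exact Or.inl ⟨Subtype.ext (by rw [hrr]; norm_num), by linarith⟩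
    obtain ⟨h3, h4⟩ := hG.coneMap_end u' hr hend
    have hFx : ((F (e, u)).1, u') = F (e, u) := Prod.ext rfl h2
    rw [h3, h4, hFx, hGF, h1']
    exact ⟨by linear_combination ((s : ℝ) - 1 / 2) * hδ, rfl⟩

theorem RespectsEnds.cutPolar_coneMap_congr
    {F : unitInterval × Circle → unitInterval × Circle} {δ : ℝ}
    (hF : RespectsEnds F δ) (h01 : ∀ u, (F (0, u)).2 = (F (1, u)).2)
    (y y' : unitInterval × unitInterval × Circle)
    (h : SolidTorus.cutPolar y = SolidTorus.cutPolar y') :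
    SolidTorus.cutPolar (coneMap F δ y) = SolidTorus.cutPolar (coneMap F δ y') := by
  have hexp : Circle.exp (2 * Real.pi * (1 / 2 + δ * ((0 : unitInterval) - 1 / 2))) =
      Circle.exp (2 * Real.pi * (1 / 2 + δ * ((1 : unitInterval) - 1 / 2))) := by
    rcases hF.sign with rfl | rfl
    · norm_num
    · norm_num
  have hzero : ∀ s s' : unitInterval, ∀ u u' : Circle,
      SolidTorus.cutPolar (0, s, u) = SolidTorus.cutPolar (0, s', u') →
      SolidTorus.cutPolar (coneMap F δ (0, s, u)) = SolidTorus.cutPolar (coneMap F δ (0, s', u')) := by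
    intro s s' u u' h
    refine SolidTorus.cutPolar_eq_iff.2 ⟨?_, rfl, Or.inl rfl⟩
    rw [hF.coneMap_zero, hF.coneMap_zero]
    rcases Circle.exp_two_pi_unitInterval_eq_iff.1 (SolidTorus.cutPolar_eq_iff.1 h).1 with
      h | ⟨h, h'⟩ | ⟨h, h'⟩
    · simp only at h; rw [h]
    · simp only at h h'; rw [h, h', hexp]
    · simp only at h h'; rw [h, h', hexp]
  have hpos : ∀ (r : unitInterval) (u : Circle), r ≠ 0 →
      SolidTorus.cutPolar (coneMap F δ (r, 0, u)) = SolidTorus.cutPolar (coneMap F δ (r, 1, u)) := by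
    intro r u hr
    have hr1 := r.2.2
    obtain ⟨h1, h2⟩ := hF.coneMap_end (s := 0) u hr (Or.inl ⟨rfl, by rw [Icc.coe_zero]; linarith⟩)
    obtain ⟨h3, h4⟩ := hF.coneMap_end (s := 1) u hr (Or.inr ⟨rfl, by rw [Icc.coe_one]; linarith⟩)
    exact SolidTorus.cutPolar_eq_iff.2 ⟨by rw [h1, h3, hexp], rfl, Or.inr (by rw [h2, h4, h01])⟩
  obtain ⟨r, s, u⟩ := y
  obtain ⟨r', s', u'⟩ := y'
  obtain ⟨h1, h2, h3⟩ := SolidTorus.cutPolar_eq_iff.1 h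
  simp only at h1 h2 h3
  subst h2
  rcases eq_or_ne r 0 with rfl | hr
  · exact hzero _ _ _ _ h
  · obtain rfl := h3.resolve_left hr
    rcases Circle.exp_two_pi_unitInterval_eq_iff.1 h1 with rfl | ⟨rfl, rfl⟩ | ⟨rfl, rfl⟩
    · rfl
    · exact hpos r u hr
    · exact (hpos r u hr).symm

/-- A homeomorphism of the boundary torus that preserves the meridian `{1} × S¹` extends over the
solid torus. -/
theorem exists_solidTorus_extension_of_meridian (c : Circle × Circle ≃ₜ Circle × Circle)
    (hc : c '' ({1} ×ˢ univ) = {1} ×ˢ univ) :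
    ∃ C : SolidTorus ≃ₜ SolidTorus,
      ∀ x, C (SolidTorus.boundary x) = SolidTorus.boundary (c x) := by
  have h1 : ∀ x, (c x).1 = 1 ↔ x.1 = 1 := fun x => by
    have : c x ∈ c '' ({1} ×ˢ univ) ↔ x ∈ ({1} ×ˢ univ : Set (Circle × Circle)) :=
      c.injective.mem_set_image
    rw [hc] at this
    simpa using this
  have h1' : ∀ x, (c.symm x).1 = 1 ↔ x.1 = 1 := fun x => by
    rw [← h1, c.apply_symm_apply]
  obtain ⟨F, hF, hFc, hF0, hF1⟩ := exists_annulus_lift c.continuous h1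
  obtain ⟨G, hG, hGc, hG0, hG1⟩ := exists_annulus_lift c.symm.continuous h1'
  have hGF := annulus_lift_leftInverse c.symm_apply_apply hF hG hFc hGc
  have hFG := annulus_lift_leftInverse c.apply_symm_apply hG hF hGc hFc
  obtain ⟨δ, hFδ, hGδ⟩ : ∃ δ, RespectsEnds F δ ∧ RespectsEnds G δ := by
    rcases annulus_lift_ends hGF hF0 hF1 hG0 hG1 with h | h
    · refine ⟨1, ⟨Or.inl rfl, fun u => ?_, fun u => ?_⟩, ⟨Or.inl rfl, fun u => ?_, fun u => ?_⟩⟩ <;>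
      simp [h u]
      all_goals norm_num
    · refine ⟨-1, ⟨Or.inr rfl, fun u => ?_, fun u => ?_⟩,
        ⟨Or.inr rfl, fun u => ?_, fun u => ?_⟩⟩ <;>
      simp [h u]
      all_goals norm_num
  have hend : ∀ u, annulusToTorus (0, u) = annulusToTorus (1, u) := fun u => by
    simp [annulusToTorus]
  have hF01 : ∀ u, (F (0, u)).2 = (F (1, u)).2 := fun u => by
    have := (hFc (0, u)).trans ((congrArg c (hend u)).trans (hFc (1, u)).symm)
    exact (Prod.ext_iff.1 this).2
  have hG01 : ∀ u, (G (0, u)).2 = (G (1, u)).2 := fun u => by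
    have := (hGc (0, u)).trans ((congrArg c.symm (hend u)).trans (hGc (1, u)).symm)
    exact (Prod.ext_iff.1 this).2
  obtain ⟨C, hC⟩ := exists_homeomorph_of_semiconj SolidTorus.continuous_cutPolar
    SolidTorus.cutPolar_surjective (continuous_cutPolar_coneMap hF δ)
    (hFδ.cutPolar_coneMap_congr hF01) (hGδ.cutPolar_coneMap_congr hG01)
    (hFδ.cutPolar_coneMap_coneMap hGδ hGF) (hGδ.cutPolar_coneMap_coneMap hFδ hFG)
  refine ⟨C, fun x => ?_⟩
  obtain ⟨⟨s, u⟩, rfl⟩ := annulusToTorus_surjective x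
  rw [← hFc, ← SolidTorus.polar_one, ← SolidTorus.polar_one]
  refine (hC (1, s, u)).trans (congrArg SolidTorus.polar (Prod.ext rfl ?_))
  obtain ⟨h2, h3⟩ := coneMap_side (F := F) (δ := δ) (r := 1) (s := s) (x := s) u one_ne_zero
    (by simp)
  change annulusToTorus (coneMap F δ (1, s, u)).2 = _
  congr 1
  exact Prod.ext (Subtype.ext (by rw [h2]; simp)) h3

/-- The homeomorphism `(z, w) ↦ (z * w ^ k, w)` of the torus. -/
noncomputable def torusTwist (k : ℤ) : Circle × Circle ≃ₜ Circle × Circle where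
  toFun x := (x.1 * x.2 ^ k, x.2)
  invFun x := (x.1 * x.2 ^ (-k), x.2)
  left_inv x := by simp [mul_assoc]
  right_inv x := by simp [mul_assoc]
  continuous_toFun := by fun_prop
  continuous_invFun := by fun_prop

theorem torusTwist_apply (k : ℤ) (x : Circle × Circle) :
    torusTwist k x = (x.1 * x.2 ^ k, x.2) := rfl

theorem torusTwist_image_meridian (k : ℤ) :
    torusTwist k '' ({1} ×ˢ univ) = slopeCurve k := by
  ext x
  constructor
  · rintro ⟨⟨a, u⟩, ⟨rfl, -⟩, rfl⟩
    exact ⟨u, by simp [torusTwist_apply]⟩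
  · rintro ⟨u, rfl⟩
    exact ⟨(1, u), ⟨rfl, mem_univ _⟩, by simp [torusTwist_apply]⟩

/-- A homeomorphism of tori that takes the meridian to a curve isotopic to the slope curve is, up
to a homeomorphism of the solid torus, the twist. -/
theorem exists_solidTorus_extension_of_slope (a : Circle × Circle ≃ₜ Circle × Circle) (k : ℤ)
    (ha : AmbientIsotopic (a '' ({1} ×ˢ univ)) (slopeCurve k)) :
    ∃ (c : Circle × Circle ≃ₜ Circle × Circle) (C : SolidTorus ≃ₜ SolidTorus),
      (∀ x, C (SolidTorus.boundary x) = SolidTorus.boundary (c x)) ∧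
        ∀ x, a x = torusTwist k (c x) := by
  obtain ⟨H, hH, hHa⟩ := ha
  let T := torusTwist k
  have hJ : IsAmbientIsotopy fun y : unitInterval × (Circle × Circle) =>
      T.symm (H (y.1, T y.2)) :=
    { continuous := T.symm.continuous.comp
        (hH.continuous.comp (continuous_fst.prodMk (T.continuous.comp continuous_snd)))
      isHomeomorph := fun t => T.symm.isHomeomorph.comp
        ((hH.isHomeomorph t).comp T.isHomeomorph)
      zero := fun x => by simp [hH.zero] }
  obtain ⟨C₁, hC₁⟩ := hJ.exists_solidTorus_extension
  let H₁ := (hH.isHomeomorph 1).homeomorph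
  have hH₁ : ∀ x, H₁ x = H (1, x) := fun x => rfl
  let c₂ := (a.trans H₁).trans T.symm
  have hc₂ : c₂ '' ({1} ×ˢ univ) = {1} ×ˢ univ := by
    have : c₂ '' ({1} ×ˢ univ) = T.symm '' (H₁ '' (a '' ({1} ×ˢ univ))) := by
      simp only [image_image]; rfl
    rw [this]
    have h2 : H₁ '' (a '' ({1} ×ˢ univ)) = slopeCurve k := hHa
    rw [h2, ← torusTwist_image_meridian]
    exact T.toEquiv.symm_image_image _
  obtain ⟨C₂, hC₂⟩ := exists_solidTorus_extension_of_meridian c₂ hc₂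
  refine ⟨a.trans T.symm, C₂.trans C₁.symm, fun x => ?_, fun x => (T.apply_symm_apply _).symm⟩
  change C₁.symm (C₂ _) = _
  rw [hC₂, Homeomorph.symm_apply_eq, hC₁]
  congr 1
  change T.symm (H₁ (a x)) = T.symm (H (1, T (T.symm (a x))))
  rw [T.apply_symm_apply, hH₁]

/-- The projection of the plane minus the point `a` of the unit circle to the circle, along the
lines through `a`. -/
noncomputable def circleProjection (a : Circle) (w : ℂ) : Circle :=
  if h : w - a = 0 then a else -(a⁻¹ * (Circle.ofConjDivSelf (w - a) h)⁻¹)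

theorem coe_circleProjection {a : Circle} {w : ℂ} (h : w - a ≠ 0) :
    (circleProjection a w : ℂ) = -((a : ℂ)⁻¹ * ((starRingEnd ℂ) (w - a) / (w - a))⁻¹) := by
  rw [circleProjection, dif_neg h]
  rfl

theorem circleProjection_coe (a w : Circle) : circleProjection a w = w := by
  by_cases h : (w : ℂ) - a = 0
  · rw [circleProjection, dif_pos h]
    exact (Circle.ext (sub_eq_zero.1 h)).symm
  ext
  have hw := w.coe_ne_zero
  have ha := a.coe_ne_zero
  rw [coe_circleProjection h, map_sub, ← Circle.coe_inv_eq_conj, ← Circle.coe_inv_eq_conj,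
    Circle.coe_inv, Circle.coe_inv]
  have h2 : ((w : ℂ))⁻¹ - (a : ℂ)⁻¹ = -(w - a) / (w * a) := by field_simp; ring
  rw [h2]
  field_simp

theorem continuousAt_circleProjection {a : Circle} {w : ℂ} (h : w ≠ a) :
    ContinuousAt (circleProjection a) w := by
  have h' : w - a ≠ 0 := sub_ne_zero.2 h
  have hind : IsInducing (fun z : Circle => (z : ℂ)) := IsInducing.subtypeVal
  rw [hind.continuousAt_iff]
  have hev : (fun w : ℂ => -((a : ℂ)⁻¹ * ((starRingEnd ℂ) (w - a) / (w - a))⁻¹)) =ᶠ[𝓝 w]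
      ((↑) : Circle → ℂ) ∘ circleProjection a := by
    filter_upwards [isOpen_ne.mem_nhds h] with v hv
    exact (coe_circleProjection (sub_ne_zero.2 hv)).symm
  refine ContinuousAt.congr ?_ hev
  refine ContinuousAt.neg (continuousAt_const.mul (ContinuousAt.inv₀ (ContinuousAt.div ?_ ?_ h')
    (div_ne_zero ((map_ne_zero _).2 h') h')))
  · exact (Complex.continuous_conj.comp (continuous_id.sub continuous_const)).continuousAt
  · fun_prop

/-- The twist of the solid torus, defined away from the circle `S¹ × {a}`, that extends
`torusTwist k`. -/
noncomputable def SolidTorus.twist (a : Circle) (k : ℤ) (y : SolidTorus) : SolidTorus :=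
  (y.1 * circleProjection a y.2 ^ k, y.2)

theorem SolidTorus.twist_boundary (a : Circle) (k : ℤ) (x : Circle × Circle) :
    SolidTorus.twist a k (SolidTorus.boundary x) = SolidTorus.boundary (torusTwist k x) := by
  simp [SolidTorus.twist, SolidTorus.boundary, torusTwist_apply, circleProjection_coe]

theorem SolidTorus.twist_bijective (a : Circle) (k : ℤ) :
    Function.Bijective (SolidTorus.twist a k) := by
  constructor
  · rintro ⟨z, w⟩ ⟨z', w'⟩ h
    obtain ⟨h1, h2⟩ := Prod.ext_iff.1 h
    obtain rfl : w = w' := h2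
    exact Prod.ext (mul_right_cancel h1) rfl
  · rintro ⟨z, w⟩
    exact ⟨(z * (circleProjection a w ^ k)⁻¹, w), by simp [SolidTorus.twist]⟩

theorem SolidTorus.continuousAt_twist {a : Circle} {k : ℤ} {y : SolidTorus}
    (h : (y.2 : ℂ) ≠ a) : ContinuousAt (SolidTorus.twist a k) y := by
  have h1 : ContinuousAt (fun y : SolidTorus => circleProjection a y.2) y :=
    ContinuousAt.comp (f := fun y : SolidTorus => (y.2 : ℂ)) (continuousAt_circleProjection h)
      (by fun_prop)
  exact ContinuousAt.prodMk (continuousAt_fst.mul (h1.zpow k)) continuousAt_snd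

theorem SolidTorus.mem_range_boundary {y : SolidTorus} :
    y ∈ range SolidTorus.boundary ↔ ‖(y.2 : ℂ)‖ = 1 := by
  constructor
  · rintro ⟨x, rfl⟩
    exact Circle.norm_coe _
  · intro h
    exact ⟨(y.1, ⟨y.2, by simpa [Submonoid.unitSphere] using h⟩), rfl⟩

theorem SolidTorus.norm_lt_one_iff {y : SolidTorus} :
    ‖(y.2 : ℂ)‖ < 1 ↔ y ∉ range SolidTorus.boundary := by
  have := mem_closedBall_zero_iff.1 y.2.2
  rw [SolidTorus.mem_range_boundary]
  exact this.lt_iff_ne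

section Surgery

variable {S M ι : Type*} [TopologicalSpace S] [TopologicalSpace M]

/-- The gluing of solid tori into the complement of solid tori `N i` in a fiber bundle over the
circle, by the twists, is again a fiber bundle over the circle, if the height over the base is
linear in the imaginary part of the disk coordinate of each `N i`. -/
theorem IsLocallyTrivialBundle.exists_of_twisted_gluing [T2Space M] [CompactSpace M] [Finite ι]
    {p : M → Circle} (hp : IsLocallyTrivialBundle S p) {N : ι → SolidTorus → M}
    (hNc : ∀ i, Continuous (N i)) (hNi : ∀ i, Function.Injective (N i))
    (hNd : ∀ i j x y, N i x = N j y → i = j) {W : Set M} (hW : IsOpen W)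
    (hWN : ∀ m, m ∈ W ↔ ∃ i y, ‖(y.2 : ℂ)‖ < 1 ∧ N i y = m)
    {t : ι → Circle} {ε : ι → ℝ} (hε : ∀ i, 0 < ε i ∧ ε i < Real.pi / 2)
    (hpN : ∀ i y, p (N i y) = t i * Circle.exp (ε i * (y.2 : ℂ).im))
    (k : ι → ℤ) {g : ι → Circle × Circle → {m // m ∉ W}}
    {c : ι → Circle × Circle ≃ₜ Circle × Circle} {C : ι → SolidTorus ≃ₜ SolidTorus}
    (hC : ∀ i x, C i (SolidTorus.boundary x) = SolidTorus.boundary (c i x))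
    (hg : ∀ i x, (g i x : M) = N i (SolidTorus.boundary (torusTwist (k i) (c i x)))) :
    ∃ q : DehnFilling g → Circle, IsLocallyTrivialBundle S q := by
  have hpc := hp.continuous
  have : CompactSpace {m // m ∉ W} :=
    isCompact_iff_compactSpace.1 (hW.isClosed_compl.isCompact)
  let qs : {m // m ∉ W} ⊕ (Σ _ : ι, SolidTorus) → Circle :=
    Sum.elim (fun e => p e) fun y => t y.1 * Circle.exp (ε y.1 * ((C y.1 y.2).2 : ℂ).im)
  let q : DehnFilling g → Circle := Quot.lift qs (by
    rintro _ _ ⟨i, x⟩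
    simp only [qs, Sum.elim_inl, Sum.elim_inr, hg, hpN, hC]
    rfl)
  have hq : Continuous q := by
    refine continuous_quot_lift _ (Continuous.sumElim (hpc.comp continuous_subtype_val)
      (continuous_sigma fun i => ?_))
    have hCi : Continuous fun y : SolidTorus => ε i * ((C i y).2 : ℂ).im := by
      have := (C i).continuous
      fun_prop
    exact (continuous_const_mul (t i)).comp (Circle.exp.continuous.comp hCi)
  let Φs : (ι → Circle) → {m // m ∉ W} ⊕ (Σ _ : ι, SolidTorus) → M := fun a =>
    Sum.elim (fun e => e) fun y => N y.1 (SolidTorus.twist (a y.1) (k y.1) (C y.1 y.2))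
  let Φ : (ι → Circle) → DehnFilling g → M := fun a => Quot.lift (Φs a) (by
    rintro _ _ ⟨i, x⟩
    simp only [Φs, Sum.elim_inl, Sum.elim_inr, hg, hC, SolidTorus.twist_boundary])
  have hpΦ : ∀ a z, p (Φ a z) = q z := by
    rintro a ⟨e | ⟨i, y⟩⟩
    · rfl
    · exact hpN _ _
  have hint : ∀ a i (y : SolidTorus), ‖(y.2 : ℂ)‖ < 1 →
      ‖((SolidTorus.twist a (k i) (C i y)).2 : ℂ)‖ < 1 := by
    intro a i y hy
    change ‖((C i y).2 : ℂ)‖ < 1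
    rw [SolidTorus.norm_lt_one_iff] at hy ⊢
    rintro ⟨x, hx⟩
    refine hy ⟨(c i).symm x, (C i).injective ?_⟩
    rw [hC, Homeomorph.apply_symm_apply, hx]
  have hrep : ∀ z : DehnFilling g, (∃ e, z = Quot.mk _ (Sum.inl e)) ∨
      ∃ i, ∃ y : SolidTorus, ‖(y.2 : ℂ)‖ < 1 ∧ z = Quot.mk _ (Sum.inr ⟨i, y⟩) := by
    rintro ⟨e | ⟨i, y⟩⟩
    · exact Or.inl ⟨e, rfl⟩
    · by_cases hy : y ∈ range SolidTorus.boundary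
      · obtain ⟨x, rfl⟩ := hy
        exact Or.inl ⟨g i x, (Quot.sound (DehnFillingRel.glue i x)).symm⟩
      · exact Or.inr ⟨i, y, SolidTorus.norm_lt_one_iff.2 hy, rfl⟩
  have hΦi : ∀ a, Function.Injective (Φ a) := by
    intro a z z' h
    have hne : ∀ (e : {m // m ∉ W}) i (y : SolidTorus), ‖(y.2 : ℂ)‖ < 1 →
        (e : M) ≠ N i (SolidTorus.twist (a i) (k i) (C i y)) := fun e i y hy he =>
      e.2 ((hWN _).2 ⟨i, _, hint (a i) i y hy, he.symm⟩)
    rcases hrep z with ⟨e, rfl⟩ | ⟨i, y, hy, rfl⟩ <;>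
      rcases hrep z' with ⟨e', rfl⟩ | ⟨i', y', hy', rfl⟩
    · exact congrArg _ (congrArg _ (Subtype.ext h))
    · exact absurd h (hne e i' y' hy')
    · exact absurd h.symm (hne e' i y hy)
    · obtain rfl : i = i' := hNd _ _ _ _ h
      have hy : y = y' := (C i).injective ((SolidTorus.twist_bijective _ _).1 (hNi i h))
      rw [hy]
  have hΦs : ∀ a, Function.Surjective (Φ a) := by
    intro a m
    by_cases hm : m ∈ W
    · obtain ⟨i, y, -, rfl⟩ := (hWN m).1 hm
      obtain ⟨y', rfl⟩ := (SolidTorus.twist_bijective (a i) (k i)).2 y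
      obtain ⟨x, rfl⟩ := (C i).surjective y'
      exact ⟨Quot.mk _ (Sum.inr ⟨i, x⟩), rfl⟩
    · exact ⟨Quot.mk _ (Sum.inl ⟨m, hm⟩), rfl⟩
  refine ⟨q, hp.of_locally_bijOn hq fun b => ?_⟩
  have ha : ∀ i, ∃ a : Circle, b ≠ t i * Circle.exp (ε i * (a : ℂ).im) := by
    intro i
    by_contra! hb
    have h1 := hb (Circle.exp (Real.pi / 2))
    have h2 := hb (Circle.exp (-(Real.pi / 2)))
    rw [h1] at h2
    have h3 := mul_left_cancel h2
    simp only [Circle.coe_exp, Complex.exp_ofReal_mul_I_im, Real.sin_neg, Real.sin_pi_div_two,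
      mul_one, mul_neg] at h3
    have h4 := Circle.exp_injOn_Icc (a := -ε i) (b := ε i) (by linarith [(hε i).2, Real.pi_pos])
      ⟨by linarith [(hε i).1], le_rfl⟩ ⟨le_rfl, by linarith [(hε i).1]⟩ h3
    linarith [(hε i).1]
  choose a ha using ha
  have hU : IsOpen (⋂ i, {b' : Circle | b' ≠ t i * Circle.exp (ε i * (a i : ℂ).im)}) :=
    isOpen_iInter_of_finite fun i => isOpen_ne
  refine ⟨_, hU, mem_iInter.2 ha, Φ a, ?_, ?_, fun z _ => hpΦ a z⟩
  · refine (isQuotientMap_quot_mk.continuousOn_isOpen_iff (hU.preimage hq)).2 ?_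
    intro z hz
    refine ContinuousAt.continuousWithinAt ?_
    change ContinuousAt (Φs a) z
    rcases z with e | ⟨i, y⟩
    · rw [← IsOpenEmbedding.inl.continuousAt_iff]
      exact continuous_subtype_val.continuousAt
    · rw [← IsOpenEmbedding.inr.continuousAt_iff, ← IsOpenEmbedding.sigmaMk.continuousAt_iff]
      have hy : t i * Circle.exp (ε i * ((C i y).2 : ℂ).im) ≠
          t i * Circle.exp (ε i * (a i : ℂ).im) := mem_iInter.1 hz i
      have hya : ((C i y).2 : ℂ) ≠ a i := fun h => hy (by rw [h])
      have hT : ContinuousAt (fun y => SolidTorus.twist (a i) (k i) (C i y)) y :=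
        ContinuousAt.comp (SolidTorus.continuousAt_twist hya) (C i).continuous.continuousAt
      exact ContinuousAt.comp (g := N i) (hNc i).continuousAt hT
  · refine ⟨fun z hz => ?_, (hΦi a).injOn, fun m hm => ?_⟩
    · rw [mem_preimage, hpΦ]; exact hz
    · obtain ⟨z, rfl⟩ := hΦs a m
      exact ⟨z, by rw [mem_preimage, ← hpΦ a]; exact hm, rfl⟩

end Surgery

theorem IsLocallyTrivialBundle.comp_homeomorph {S M M' B : Type*} [TopologicalSpace S]
    [TopologicalSpace M] [TopologicalSpace M'] [TopologicalSpace B] {p : M → B}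
    (hp : IsLocallyTrivialBundle S p) (h : M' ≃ₜ M) : IsLocallyTrivialBundle S (p ∘ h) := by
  intro b
  obtain ⟨e, he⟩ := hp b
  exact ⟨e.compHomeomorph h, he⟩

/-- The inclusion of the solid torus in `S¹ × ℂ`. -/
def SolidTorus.toProd (y : SolidTorus) : Circle × ℂ := (y.1, y.2)

theorem SolidTorus.continuous_toProd : Continuous SolidTorus.toProd := by
  unfold SolidTorus.toProd
  fun_prop

theorem SolidTorus.toProd_injective : Function.Injective SolidTorus.toProd := by
  rintro ⟨z, w⟩ ⟨z', w'⟩ h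
  obtain ⟨h1, h2⟩ := Prod.ext_iff.1 h
  exact Prod.ext h1 (Subtype.ext h2)

theorem SolidTorus.toProd_mem (y : SolidTorus) : y.toProd ∈ closedTube 1 :=
  ⟨mem_univ _, y.2.2⟩

theorem closedTube_one_subset : closedTube 1 ⊆ openTube 2 :=
  prod_mono_right (Metric.closedBall_subset_ball (by norm_num))

theorem openTube_mono {r r' : ℝ} (h : r ≤ r') : openTube r ⊆ openTube r' :=
  prod_mono_right (Metric.ball_subset_ball h)

theorem isOpen_openTube (r : ℝ) : IsOpen (openTube r) :=
  isOpen_univ.prod Metric.isOpen_ball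

theorem mainTheorem8
    {S : Type*} [TopologicalSpace S] [T2Space S] [CompactSpace S]
    [ChartedSpace (EuclideanHalfSpace 2) S]
    {M : Type*} [TopologicalSpace M] [T2Space M] [CompactSpace M]
    (p : M → Circle) (hp : IsLocallyTrivialBundle S p)
    {n : ℕ} (t : Fin n → Circle) (ht : Function.Injective t)
    (γ : ∀ i, C(Circle, p ⁻¹' {t i})) (hγ : ∀ i, IsBubble (γ i))
    (ν : Fin n → Circle × ℂ → M) (hν : IsRegularNeighborhood γ ν)
    (k : Fin n → ℤ)
    (g : Fin n → Circle × Circle → DrilledManifold ν)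
    (hg : ∀ i, IsAttachingMap (ν i) (k i) fun x => (g i x : M)) :
    ∃ q : DehnFilling g → Circle, IsLocallyTrivialBundle S q := by
  obtain ⟨τ, H, hτ, hdisj, hH, -, hντ⟩ := hν
  choose a ha hga using hg
  choose c C hC hac using fun i => exists_solidTorus_extension_of_slope (a i) (k i) (ha i)
  choose ε hε0 hε1 hheight using fun i => (hτ i).height
  let h : M ≃ₜ M := (hH.isHomeomorph 1).homeomorph
  have hh : ∀ i, ∀ x ∈ closedTube 1, ν i x = h (τ i x) := fun i x hx => hντ i x hx
  have hτi : ∀ i, InjOn (τ i) (openTube 2) := fun i =>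
    injOn_iff_injective.2 (hτ i).isOpenEmbedding.injective
  have hτc : ∀ i, ContinuousOn (τ i) (openTube 2) := fun i =>
    continuousOn_iff_continuous_domRestrict.2 (hτ i).isOpenEmbedding.continuous
  have hsub : openTube 1 ⊆ closedTube 1 := prod_mono_right Metric.ball_subset_closedBall
  have hN : ∀ i (y : SolidTorus), ν i y.toProd = h (τ i y.toProd) := fun i y =>
    hh i _ y.toProd_mem
  have hmem : ∀ y : SolidTorus, y.toProd ∈ openTube 2 := fun y =>
    closedTube_one_subset y.toProd_mem
  refine (hp.comp_homeomorph h.symm).exists_of_twisted_gluing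
    (N := fun i y => ν i y.toProd) (fun i => ?_) (fun i y y' hy => ?_) (fun i j y y' hy => ?_)
    (isOpen_iUnion fun i => ?_) (fun m => ?_) (t := t) (ε := ε)
    (fun i => ⟨hε0 i, hε1 i⟩) (fun i y => ?_) k hC (fun i x => ?_)
  · simp only [hN]
    exact h.continuous.comp ((hτc i).comp_continuous SolidTorus.continuous_toProd hmem)
  · simp only [hN] at hy
    exact SolidTorus.toProd_injective (hτi i (hmem y) (hmem y') (h.injective hy))
  · simp only [hN] at hy
    by_contra hij
    exact disjoint_left.1 (hdisj hij) (mem_image_of_mem _ y.toProd_mem)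
      (h.injective hy ▸ mem_image_of_mem _ y'.toProd_mem)
  · have h1 : ν i '' openTube 1 = h '' (τ i '' openTube 1) := by
      rw [image_image]
      exact image_congr fun x hx => hh i x (hsub hx)
    have h2 : τ i '' openTube 1 = (openTube 2).domRestrict (τ i) '' (Subtype.val ⁻¹' openTube 1) := by
      rw [domRestrict_eq, image_comp, Subtype.image_preimage_coe,
        inter_eq_right.2 (openTube_mono one_le_two)]
    rw [h1, h2]
    exact h.isOpenMap _ ((hτ i).isOpenEmbedding.isOpenMap _
      ((isOpen_openTube 1).preimage continuous_subtype_val))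
  · rw [mem_iUnion]
    refine exists_congr fun i => ⟨?_, ?_⟩
    · rintro ⟨⟨z, w⟩, hw, rfl⟩
      exact ⟨(z, ⟨w, (hsub hw).2⟩), mem_ball_zero_iff.1 hw.2, rfl⟩
    · rintro ⟨y, hy, rfl⟩
      exact mem_image_of_mem _ ⟨mem_univ _, mem_ball_zero_iff.2 hy⟩
  · simp only [Function.comp_apply, hN, Homeomorph.symm_apply_apply]
    exact hheight i _ (hmem y)
  · refine (hga i x).trans ?_
    rw [hac i x]
    rfl
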